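/- **Theorem (straight-line base configuration with 19 lines).** For $i=1,\dots,18$ let $m_i^*$ and $a_i$ be - $m_{1}^*=-0.18006$, $a_{1}=-\tan(8\pi/18)$ - $m_{2}^*=-0.25231$, $a_{2}=-\tan(4\pi/18)$ - $m_{3}^*=-0.32584$, $a_{3}=-\tan(6\pi/18)$ - $m_{4}^*=-1.74521$, $a_{4}=\tan(7\pi/18)$ - $m_{5}^*=-2.17941$, $a_{5}=\tan(\pi/18)$ - $m_{6}^*=-2.79557$, $a_{6}=\tan(5\pi/18)$ - $m_{7}^*=-4.59586$, $a_{7}=-\tan(5\pi/18)$ - $m_{8}^*=-5.67203$, $a_{8}=-\varepsilon$ - $m_{9}^*=-7.39905$, $a_{9}=-\tan(2\pi/18)$ - $m_{10}^*=-23.07892$, $a_{10}=\tan(3\pi/18)$ - $m_{11}^*=4.39005$, $a_{11}=-\tan(7\pi/18)$ - $m_{12}^*=2.90204$, $a_{12}=-\tan(3\pi/18)$ - $m_{13}^*=1.31845$, $a_{13}=\tan(2\pi/18)$ - $m_{14}^*=0.90192$, $a_{14}=\tan(4\pi/18)$ - $m_{15}^*=0.84501$, $a_{15}=\varepsilon$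 - $m_{16}^*=0.64068$, $a_{16}=\tan(6\pi/18)$ - $m_{17}^*=0.44393$, $a_{17}=-\tan(\pi/18)$ - $m_{18}^*=0.15548$, $a_{18}=\tan(8\pi/18)$ For every $\varepsilon\in(0,10^{-4})$ and all $m_i\in[m_i^*-10^{-4},\,m_i^*+10^{-4}]$ ($i=1,\dots,18$), the $19$ lines $Y_0: y=0$ and $L_i: y=m_i(x-a_i)$, $i=1,\dots,18$, form a simple affine arrangement in $\mathbb R^2$: any two of the lines cross in exactly one point and no point lies on three of them. Moreover: 1. $\{a_1,\dots,a_{18}\}=\{\pm\tan(k\pi/18)\mid k=1,\dots,8\}\cup\{-\varepsilon,\varepsilon\}$, and $\varepsilon<1/36$. 2. With $L_0=Y_0$, the arrangement realizes the order matrix ($\mathrm O$-matrix) whose rows, for $L_0,L_1,\dots,L_{18}$ in this order, are $$\left(\begin{smallmatrix} 1 & 11 & 3 & 7 & 2 & 12 & 9 & 17 & 8 & 15 & 5 & 13 & 10 & 14 & 6 & 16 & 4 & 18 \\ 0 & 11 & 17 & 7 & 15 & 12 & 18 & 13 & 14 & 9 & 16 & 8 & 10 & 5 & 6 & 3 & 4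 & 2 \\ 3 & 11 & 7 & 0 & 12 & 17 & 9 & 15 & 8 & 13 & 5 & 14 & 10 & 16 & 6 & 18 & 4 & 1 \\ 2 & 11 & 0 & 7 & 17 & 12 & 15 & 9 & 13 & 8 & 14 & 5 & 16 & 10 & 18 & 6 & 1 & 4 \\ 5 & 7 & 6 & 9 & 8 & 11 & 10 & 12 & 13 & 15 & 14 & 17 & 16 & 0 & 18 & 2 & 1 & 3 \\ 4 & 7 & 11 & 9 & 12 & 8 & 17 & 15 & 0 & 13 & 2 & 14 & 3 & 16 & 18 & 10 & 1 & 6 \\ 7 & 4 & 9 & 11 & 8 & 12 & 10 & 15 & 13 & 17 & 14 & 0 & 16 & 2 & 18 & 3 & 1 & 5 \\ 6 & 4 & 5 & 11 & 2 & 0 & 3 & 17 & 1 & 15 & 18 & 12 & 14 & 13 & 16 & 9 & 10 & 8 \\ 9 & 4 & 11 & 6 & 12 & 5 & 17 & 0 & 15 & 2 & 13 & 3 & 14 & 18 & 16 & 1 & 10 & 7 \\ 8 & 4 & 6 & 11 & 5 & 12 & 0 & 17 & 2 & 15 & 3 & 13 & 18 & 14 & 1 & 16 & 7 & 10 \\ 11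 & 4 & 12 & 6 & 15 & 17 & 13 & 0 & 14 & 2 & 16 & 3 & 18 & 5 & 1 & 8 & 7 & 9 \\ 10 & 4 & 8 & 6 & 9 & 5 & 7 & 2 & 3 & 0 & 1 & 17 & 18 & 15 & 16 & 14 & 13 & 12 \\ 4 & 10 & 6 & 8 & 5 & 9 & 0 & 2 & 17 & 3 & 15 & 1 & 18 & 7 & 14 & 16 & 13 & 11 \\ 4 & 15 & 6 & 17 & 10 & 0 & 5 & 2 & 8 & 3 & 9 & 18 & 1 & 14 & 7 & 16 & 12 & 11 \\ 15 & 4 & 17 & 6 & 0 & 10 & 2 & 5 & 3 & 8 & 18 & 9 & 1 & 13 & 7 & 12 & 16 & 11 \\ 14 & 4 & 13 & 6 & 10 & 17 & 5 & 0 & 8 & 2 & 9 & 3 & 12 & 1 & 7 & 18 & 11 & 16 \\ 17 & 4 & 0 & 6 & 2 & 10 & 3 & 5 & 18 & 8 & 1 & 9 & 7 & 13 & 12 & 14 & 11 & 15 \\ 16 & 4 & 14 & 6 & 13 & 10 & 15 & 5 & 8 & 0 & 9 & 2 & 12 & 3 & 7 & 1 & 11 & 18 \\ 0 & 4 & 2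 & 6 & 3 & 10 & 5 & 16 & 8 & 14 & 9 & 13 & 1 & 12 & 7 & 15 & 11 & 17 \end{smallmatrix}\right).$$ This means that there is a directed line $\gamma$, parallel to no line of the arrangement, that is translated across the plane towards its right-hand side, such that at an initial position before all crossings it meets the lines, along its direction, in the order $L_0,L_1,\dots,L_{18}$, and such that row $i$ lists the indices $j\ne i$ in the order in which $\gamma$ sweeps the points $L_i\cap L_j$. 3. $Y_0$ touches exactly $17$ of the bounded triangular faces of the arrangement, that is, it contains a side of exactly $17$ of them. (Faces are the connected components of the complement of the union of the lines.) 4. The arrangement has exactly $107$ bounded triangular faces. 5. Consequently, with $n=18$ and the special pair $a_8=-\varepsilon$, $a_{15}=\varepsilon$, the hypotheses of the iterative construction of Bartholdi, Blanc and Loisel hold: $n\ge2$ is even; the arrangement is simple; $\{a_i\mid i\ne 8,15\}=\{\pm\tan(k\pi/n)\mid k=1,\dots,n/2-1\}$; $-1/n<a_8<0<a_{15}<1/n$; $Y_0$ touches exactly $n-1$ bounded triangular faces; and $|a_8|,|a_{15}|<1/(2n)$. -/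

import Mathlib

namespace LineArrangement

/-- A subset of the real affine plane is a straight line. -/
def IsLine (l : Set (ℝ × ℝ)) : Prop :=
  ∃ α β γ : ℝ, (α ≠ 0 ∨ β ≠ 0) ∧ l = {p | α * p.1 + β * p.2 = γ}

/-- A simple affine arrangement of straight lines: any two of the lines cross in exactly one point
(so the lines are distinct and no two are parallel), and no point lies on three of them. -/
structure IsSimple {ι : Type*} (A : ι → Set (ℝ × ℝ)) : Prop where
  isLine : ∀ i, IsLine (A i)
  cross : ∀ i j, i ≠ j → ∃! p, p ∈ A i ∧ p ∈ A j
  noTriple : ∀ i j k, i ≠ j → i ≠ k → j ≠ k → ¬ ∃ p, p ∈ A i ∧ p ∈ A j ∧ p ∈ A k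

/-- The faces of an arrangement: the connected components of the complement of its lines. -/
def IsFace {ι : Type*} (A : ι → Set (ℝ × ℝ)) (F : Set (ℝ × ℝ)) : Prop :=
  ∃ x ∈ (⋃ i, A i)ᶜ, F = connectedComponentIn (⋃ i, A i)ᶜ x

/-- `F` is the open (nondegenerate) triangle with the vertices `v 0`, `v 1`, `v 2`. -/
def IsOpenTriangle (v : Fin 3 → ℝ × ℝ) (F : Set (ℝ × ℝ)) : Prop :=
  AffineIndependent ℝ v ∧ F = interior (convexHull ℝ (Set.range v))

/-- The set of bounded triangular faces of an arrangement. -/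
def boundedTriangles {ι : Type*} (A : ι → Set (ℝ × ℝ)) : Set (Set (ℝ × ℝ)) :=
  {F | IsFace A F ∧ Bornology.IsBounded F ∧ ∃ v, IsOpenTriangle v F}

/-- The line `l` touches the triangle `F`: it contains one of the sides of `F`. -/
def Touches (l : Set (ℝ × ℝ)) (F : Set (ℝ × ℝ)) : Prop :=
  ∃ v, IsOpenTriangle v F ∧ ∃ i j, i ≠ j ∧ segment ℝ (v i) (v j) ⊆ l

/-- The bounded triangular faces of the arrangement that its line number `i` touches. -/
def touchedTriangles {ι : Type*} (A : ι → Set (ℝ × ℝ)) (i : ι) : Set (Set (ℝ × ℝ)) :=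
  {F | F ∈ boundedTriangles A ∧ Touches (A i) F}

/-- `O` is the order matrix of the simple arrangement `A`, obtained from some sweep line.
The sweep line at time `t` is `u * x + v * y = t`; it moves in the direction `(u, v)` and is itself
directed by `(-v, u)`, so it moves towards its right-hand side (for `(u, v) = (0, -1)`, it is
directed by `(1, 0)` and moves downwards). It is parallel to no line of the arrangement. At some initial time `T`,
before all crossings, it meets the lines in the order `0, 1, ..., n`. Row `i` of `O` lists
the other lines in the order in which their crossings with line `i` are swept. -/
def RealizesOMatrix {n : ℕ} (A : Fin (n + 1) → Set (ℝ × ℝ))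
    (O : Matrix (Fin (n + 1)) (Fin n) (Fin (n + 1))) : Prop :=
  IsSimple A ∧ ∃ u v : ℝ,
    (∀ i t, ∃! p : ℝ × ℝ, p ∈ A i ∧ u * p.1 + v * p.2 = t) ∧
    (∃ T : ℝ,
      (∀ i j, i ≠ j → ∀ p : ℝ × ℝ, p ∈ A i → p ∈ A j → T < u * p.1 + v * p.2) ∧
      (∀ i j, i < j → ∀ p q : ℝ × ℝ, p ∈ A i → u * p.1 + v * p.2 = T →
        q ∈ A j → u * q.1 + v * q.2 = T → -v * p.1 + u * p.2 < -v * q.1 + u * q.2)) ∧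
    (∀ i, (∀ k, O i k ≠ i) ∧ Function.Injective (O i) ∧
      ∀ k l, k < l → ∀ p q : ℝ × ℝ, p ∈ A i → p ∈ A (O i k) → q ∈ A i → q ∈ A (O i l) →
        u * p.1 + v * p.2 < u * q.1 + v * q.2)

/-- The lines `Y₀ : y = 0` (number `0`) and `Lᵢ : y = mᵢ (x - aᵢ)` (number `i`, `i = 1, ..., n`).
The slope and the intercept of `Lᵢ` are the entries number `i - 1` of `m` and `a`. -/
def normalizedFamily {n : ℕ} (m a : Fin n → ℝ) : Fin (n + 1) → Set (ℝ × ℝ) :=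
  Fin.cons {p | p.2 = 0} (fun i => {p | p.2 = m i * (p.1 - a i)})

/-- The set `{± tan (k π / n) | k = 1, ..., n / 2 - 1}`, for even `n ≥ 2`. -/
def tanNodes (n : ℕ) : Set ℝ :=
  {x | ∃ k : ℕ, 1 ≤ k ∧ k ≤ n / 2 - 1 ∧
    (x = Real.tan (k * Real.pi / n) ∨ x = -Real.tan (k * Real.pi / n))}

/-- The hypotheses of the Bartholdi-Blanc-Loisel doubling step for `n + 1` lines, together with the
condition under which the step can be iterated; `r` and `s` are the positions of
the two special lines (which come last in the usual numbering). -/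
structure BBLIterationHypotheses {n : ℕ} (m a : Fin n → ℝ) (r s : Fin n) : Prop where
  two_le : 2 ≤ n
  even : Even n
  special_ne : r ≠ s
  simple : IsSimple (normalizedFamily m a)
  nodes : a '' {i | i ≠ r ∧ i ≠ s} = tanNodes n
  special_neg : -(1 / (n : ℝ)) < a r ∧ a r < 0
  special_pos : 0 < a s ∧ a s < 1 / (n : ℝ)
  touch : (touchedTriangles (normalizedFamily m a) 0).ncard = n - 1
  iterate : |a r| < 1 / (2 * (n : ℝ)) ∧ |a s| < 1 / (2 * (n : ℝ))

/-- The centers of the slope intervals, for the lines `L₁, ..., L₁₈`. -/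
noncomputable def slopeCenter : Fin 18 → ℝ :=
  ![-0.18006, -0.25231, -0.32584, -1.74521, -2.17941, -2.79557,
    -4.59586, -5.67203, -7.39905, -23.07892, 4.39005, 2.90204,
    1.31845, 0.90192, 0.84501, 0.64068, 0.44393, 0.15548]

/-- The `x`-intercepts of the lines `L₁, ..., L₁₈`. -/
noncomputable def intercept (ε : ℝ) : Fin 18 → ℝ :=
  ![-Real.tan (8 * Real.pi / 18), -Real.tan (4 * Real.pi / 18), -Real.tan (6 * Real.pi / 18),
    Real.tan (7 * Real.pi / 18), Real.tan (1 * Real.pi / 18), Real.tan (5 * Real.pi / 18),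
    -Real.tan (5 * Real.pi / 18), -ε, -Real.tan (2 * Real.pi / 18),
    Real.tan (3 * Real.pi / 18), -Real.tan (7 * Real.pi / 18), -Real.tan (3 * Real.pi / 18),
    Real.tan (2 * Real.pi / 18), Real.tan (4 * Real.pi / 18), ε,
    Real.tan (6 * Real.pi / 18), -Real.tan (1 * Real.pi / 18), Real.tan (8 * Real.pi / 18)]

/-- The order matrix of the base configuration. -/
def baseOMatrix : Matrix (Fin 19) (Fin 18) (Fin 19) :=
  !![1, 11, 3, 7, 2, 12, 9, 17, 8, 15, 5, 13, 10, 14, 6, 16, 4, 18;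
     0, 11, 17, 7, 15, 12, 18, 13, 14, 9, 16, 8, 10, 5, 6, 3, 4, 2;
     3, 11, 7, 0, 12, 17, 9, 15, 8, 13, 5, 14, 10, 16, 6, 18, 4, 1;
     2, 11, 0, 7, 17, 12, 15, 9, 13, 8, 14, 5, 16, 10, 18, 6, 1, 4;
     5, 7, 6, 9, 8, 11, 10, 12, 13, 15, 14, 17, 16, 0, 18, 2, 1, 3;
     4, 7, 11, 9, 12, 8, 17, 15, 0, 13, 2, 14, 3, 16, 18, 10, 1, 6;
     7, 4, 9, 11, 8, 12, 10, 15, 13, 17, 14, 0, 16, 2, 18, 3, 1, 5;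
     6, 4, 5, 11, 2, 0, 3, 17, 1, 15, 18, 12, 14, 13, 16, 9, 10, 8;
     9, 4, 11, 6, 12, 5, 17, 0, 15, 2, 13, 3, 14, 18, 16, 1, 10, 7;
     8, 4, 6, 11, 5, 12, 0, 17, 2, 15, 3, 13, 18, 14, 1, 16, 7, 10;
     11, 4, 12, 6, 15, 17, 13, 0, 14, 2, 16, 3, 18, 5, 1, 8, 7, 9;
     10, 4, 8, 6, 9, 5, 7, 2, 3, 0, 1, 17, 18, 15, 16, 14, 13, 12;
     4, 10, 6, 8, 5, 9, 0, 2, 17, 3, 15, 1, 18, 7, 14, 16, 13, 11;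
     4, 15, 6, 17, 10, 0, 5, 2, 8, 3, 9, 18, 1, 14, 7, 16, 12, 11;
     15, 4, 17, 6, 0, 10, 2, 5, 3, 8, 18, 9, 1, 13, 7, 12, 16, 11;
     14, 4, 13, 6, 10, 17, 5, 0, 8, 2, 9, 3, 12, 1, 7, 18, 11, 16;
     17, 4, 0, 6, 2, 10, 3, 5, 18, 8, 1, 9, 7, 13, 12, 14, 11, 15;
     16, 4, 14, 6, 13, 10, 15, 5, 8, 0, 9, 2, 12, 3, 7, 1, 11, 18;
     0, 4, 2, 6, 3, 10, 5, 16, 8, 14, 9, 13, 1, 12, 7, 15, 11, 17]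

end LineArrangement

open LineArrangement

/-! Write each line as the zero set of the affine function `lineForm`, which is positive above it.
Every assertion about the arrangement is then a statement about the signs of these functions at the
crossing points, and each such sign is decided by the order of two slopes and the sign of one
determinant `tripleDet` (`lineForm_crossing_mul`). It is therefore enough to know finitely many
signs, the same for all admissible slopes and all admissible `ε`.

These signs come from integer interval arithmetic: rational bounds for the tangents and the given
slope intervals keep every determinant away from zero, except that of `Y₀`, `L₈`, `L₁₅`, which
degenerates as `ε` tends to `0` and is treated by its closed form. The sweep line is added as a
twentieth line, number `19`, so that its position is governed by the same determinants. All signs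
then equal those of one integer sample configuration (`isAbove_spec`), on which the kernel evaluates
the order matrix and the face counts.

Counting faces needs topology once. Faces are the sign cells of the affine functions
(`connectedComponentIn_compl_zeroSets`). Bounded triangular faces correspond bijectively to
increasing triples of lines whose crossing points are separated by no line
(`boundedTriangles_eq_image`, `tripleTriangle_injOn`), and a line touches such a face exactly when
it belongs to the triple (`SpansFace.touches_iff`). -/

namespace LineArrangement

/-! ### Faces as sign cells, and barycentric coordinates -/

/-- The zero sets of a family of affine functions on the plane. -/
def zeroSets {ι : Type*} (f : ι → ℝ × ℝ →ᵃ[ℝ] ℝ) : ι → Set (ℝ × ℝ) := fun i => {p | f i p = 0}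

theorem mem_compl_iUnion_zeroSets {ι : Type*} {f : ι → ℝ × ℝ →ᵃ[ℝ] ℝ} {x : ℝ × ℝ} :
    x ∈ (⋃ i, zeroSets f i)ᶜ ↔ ∀ i, f i x ≠ 0 := by
  simp [zeroSets]

/-- By the intermediate value theorem no `f i` changes sign on a connected set avoiding its zeros.
Conversely, a sign cell is an intersection of open half-planes, hence convex and connected. -/
theorem connectedComponentIn_compl_zeroSets {ι : Type*} (f : ι → ℝ × ℝ →ᵃ[ℝ] ℝ) {x : ℝ × ℝ}
    (hx : ∀ i, f i x ≠ 0) :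
    connectedComponentIn (⋃ i, zeroSets f i)ᶜ x = {y | ∀ i, 0 < f i x * f i y} := by
  have hxm := mem_compl_iUnion_zeroSets.2 hx
  apply Set.Subset.antisymm
  · intro y hy i
    by_contra! hneg
    have hyU := connectedComponentIn_subset _ _ hy
    obtain ⟨z, hz, hz0⟩ := isPreconnected_connectedComponentIn.intermediate_value₂ hy
      (mem_connectedComponentIn hxm) (f := fun z => f i x * f i z) (g := fun _ => 0)
      ((continuous_const.mul (f i).continuous_of_finiteDimensional).continuousOn)
      continuousOn_const hneg (mul_self_nonneg _)
    exact mem_compl_iUnion_zeroSets.1 (connectedComponentIn_subset _ _ hz) i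
      ((mul_eq_zero.1 hz0).resolve_left (hx i))
  · apply IsPreconnected.subset_connectedComponentIn
    · apply Convex.isPreconnected
      have : {y | ∀ i, 0 < f i x * f i y} = ⋂ i, (f i x • f i) ⁻¹' Set.Ioi (0 : ℝ) := by
        ext y; simp
      rw [this]
      exact convex_iInter fun i => (convex_Ioi (0 : ℝ)).affine_preimage _
    · exact fun i => mul_self_pos.2 (hx i)
    · intro y hy
      refine mem_compl_iUnion_zeroSets.2 fun i hi => ?_
      have := hy i
      simp [hi] at this

theorem fin_three_ne_add_one : ∀ n : Fin 3, n ≠ n + 1 := by decide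

theorem fin_three_ne_add_two : ∀ n : Fin 3, n ≠ n + 2 := by decide

theorem fin_three_eq_add : ∀ n k : Fin 3, n ≠ k → k = n + 1 ∨ k = n + 2 := by decide

theorem exists_affineBasis {v : Fin 3 → ℝ × ℝ} (hv : AffineIndependent ℝ v) :
    ∃ b : AffineBasis (Fin 3) ℝ (ℝ × ℝ), ⇑b = v :=
  ⟨⟨v, hv, hv.affineSpan_eq_top_iff_card_eq_finrank_add_one.2 (by simp)⟩, rfl⟩

theorem affine_apply_eq_sum_coord (b : AffineBasis (Fin 3) ℝ (ℝ × ℝ)) (g : ℝ × ℝ →ᵃ[ℝ] ℝ)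
    (x : ℝ × ℝ) : g x = ∑ n, b.coord n x * g (b n) := by
  have h1 : ∑ n, b.coord n x = 1 := b.sum_coord_apply_eq_one x
  conv_lhs => rw [← b.affineCombination_coord_eq_self x]
  rw [Finset.map_affineCombination _ _ _ h1, Finset.affineCombination_eq_linear_combination _ _ _ h1]
  simp

theorem closure_interior_convexHull {v : Fin 3 → ℝ × ℝ} (hv : AffineIndependent ℝ v) :
    closure (interior (convexHull ℝ (Set.range v))) = convexHull ℝ (Set.range v) := by
  rw [(convex_convexHull ℝ _).closure_interior_eq_closure_of_nonempty_interior]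
  · exact ((Set.finite_range v).isCompact_convexHull ℝ).isClosed.closure_eq
  · obtain ⟨b, rfl⟩ := exists_affineBasis hv
    exact interior_convexHull_nonempty_iff_affineSpan_eq_top.2 b.tot

/-! ### Algebraic certificates for triangular faces -/

/-- The points `v n` are the vertices of a triangle whose side opposite to `v n` lies on the line
number `e n`, and no line of the family separates two of these vertices. -/
structure SpansFace {ι : Type*} (f : ι → ℝ × ℝ →ᵃ[ℝ] ℝ) (e : Fin 3 → ι) (v : Fin 3 → ℝ × ℝ) :
    Prop where
  apply_self : ∀ n, f (e n) (v n) ≠ 0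
  apply_of_ne : ∀ n k, n ≠ k → f (e n) (v k) = 0
  exists_ne_zero : ∀ l, ∃ n, f l (v n) ≠ 0
  not_separated : ∀ l, (∀ n, 0 ≤ f l (v n)) ∨ (∀ n, f l (v n) ≤ 0)

namespace SpansFace

variable {ι : Type*} {f : ι → ℝ × ℝ →ᵃ[ℝ] ℝ} {e e' : Fin 3 → ι} {v v' : Fin 3 → ℝ × ℝ}

theorem injective (h : SpansFace f e v) : Function.Injective e := by
  intro n k hnk
  by_contra hne
  exact h.apply_self k (hnk ▸ h.apply_of_ne n k hne)

theorem comp (h : SpansFace f e v) (σ : Equiv.Perm (Fin 3)) : SpansFace f (e ∘ σ) (v ∘ σ) where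
  apply_self n := h.apply_self (σ n)
  apply_of_ne n k hnk := h.apply_of_ne _ _ (σ.injective.ne hnk)
  exists_ne_zero l := by
    obtain ⟨n, hn⟩ := h.exists_ne_zero l
    exact ⟨σ.symm n, by simpa using hn⟩
  not_separated l := (h.not_separated l).imp (fun H n => H _) (fun H n => H _)

theorem affineIndependent (h : SpansFace f e v) : AffineIndependent ℝ v := by
  rw [affineIndependent_iff]
  intro s w hw hwv n hn
  have h1 : ∑ k ∈ s, w k * f (e n) (v k) = 0 := by
    have h2 : ∀ p, f (e n) p = (f (e n)).linear p + f (e n) 0 := fun p => by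
      rw [(f (e n)).decomp']; simp
    have h3 := congrArg (f (e n)).linear hwv
    simp only [map_sum, map_smul, smul_eq_mul, map_zero] at h3
    rw [Finset.sum_congr rfl fun k _ => by rw [h2 (v k), mul_add], Finset.sum_add_distrib,
      ← Finset.sum_mul, hw, h3]
    simp
  -- Applying `f (e n)` to an affine relation among the vertices kills every term but the one at `v
  -- n`.
  rw [Finset.sum_eq_single_of_mem n hn fun k _ hk => by simp [h.apply_of_ne n k hk.symm]] at h1
  exact (mul_eq_zero.1 h1).resolve_right (h.apply_self n)

theorem mul_pos_of_mem_interior (h : SpansFace f e v) {y z : ℝ × ℝ}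
    (hy : y ∈ interior (convexHull ℝ (Set.range v)))
    (hz : z ∈ interior (convexHull ℝ (Set.range v))) (l : ι) : 0 < f l y * f l z := by
  obtain ⟨b, rfl⟩ := exists_affineBasis h.affineIndependent
  rw [b.interior_convexHull] at hy hz
  obtain ⟨n, hn⟩ := h.exists_ne_zero l
  have key : ∀ g : ℝ × ℝ →ᵃ[ℝ] ℝ, (∀ n, 0 ≤ g (b n)) → g (b n) ≠ 0 → ∀ y,
      (∀ i, 0 < b.coord i y) → 0 < g y := by
    intro g hg hgn y hy
    rw [affine_apply_eq_sum_coord b g y]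
    exact Finset.sum_pos' (fun i _ => mul_nonneg (hy i).le (hg i))
      ⟨n, Finset.mem_univ n, mul_pos (hy n) ((hg n).lt_of_ne' hgn)⟩
  rcases h.not_separated l with H | H
  · exact mul_pos (key (f l) H hn y hy) (key (f l) H hn z hz)
  · have K := key (-f l) (by simpa using H) (by simpa using hn)
    have h1 := K y hy
    have h2 := K z hz
    simp only [AffineMap.coe_neg, Pi.neg_apply] at h1 h2
    nlinarith

/-- Interior points have positive barycentric coordinates, so each line function has constant sign
there. Conversely, `f (e n)` is a nonzero multiple of the coordinate number `n`, so the signs on the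
three sides alone force a point of the cell into the triangle. -/
theorem isFace (h : SpansFace f e v) :
    IsFace (zeroSets f) (interior (convexHull ℝ (Set.range v))) := by
  have hv := h.affineIndependent
  obtain ⟨x, hx⟩ : (interior (convexHull ℝ (Set.range v))).Nonempty := by
    obtain ⟨b, rfl⟩ := exists_affineBasis hv
    exact interior_convexHull_nonempty_iff_affineSpan_eq_top.2 b.tot
  have hx0 : ∀ i, f i x ≠ 0 := fun i hi => by
    have := h.mul_pos_of_mem_interior hx hx i
    simp [hi] at this
  refine ⟨x, mem_compl_iUnion_zeroSets.2 hx0, ?_⟩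
  rw [connectedComponentIn_compl_zeroSets f hx0]
  refine Set.Subset.antisymm (fun y hy l => h.mul_pos_of_mem_interior hx hy l) fun y hy => ?_
  obtain ⟨b, rfl⟩ := exists_affineBasis hv
  rw [b.interior_convexHull] at hx ⊢
  intro n
  have key : ∀ z, f (e n) z = b.coord n z * f (e n) (b n) := fun z => by
    rw [affine_apply_eq_sum_coord b (f (e n)) z]
    exact Finset.sum_eq_single_of_mem n (Finset.mem_univ n) fun k _ hk => by
      simp [h.apply_of_ne n k hk.symm]
  have h1 := hy (e n)
  rw [key x, key y] at h1
  have h2 : 0 < (b.coord n x * f (e n) (b n) ^ 2) :=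
    mul_pos (hx n) (by have := h.apply_self n; positivity)
  refine pos_of_mul_pos_right (a := b.coord n x * f (e n) (b n) ^ 2) ?_ h2.le
  linarith

theorem mem_boundedTriangles (h : SpansFace f e v) :
    interior (convexHull ℝ (Set.range v)) ∈ boundedTriangles (zeroSets f) :=
  ⟨h.isFace, (isBounded_convexHull.2 (Set.finite_range v).isBounded).subset interior_subset,
    v, h.affineIndependent, rfl⟩

/-- A vertex already lies on two side lines, so by simplicity a further line misses it. All three
vertices are then strictly on one side of that line, and so is their hull. -/
theorem apply_ne_zero_of_mem_convexHull (hA : IsSimple (zeroSets f)) (h : SpansFace f e v) {l : ι}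
    (hl : l ∉ Set.range e) {y : ℝ × ℝ} (hy : y ∈ convexHull ℝ (Set.range v)) : f l y ≠ 0 := by
  have hv : ∀ n, f l (v n) ≠ 0 := by
    intro n hn
    exact hA.noTriple l (e (n + 1)) (e (n + 2)) (fun H => hl ⟨_, H.symm⟩) (fun H => hl ⟨_, H.symm⟩)
      (h.injective.ne (by simp)) ⟨v n, hn, h.apply_of_ne _ _ (fin_three_ne_add_one n).symm,
        h.apply_of_ne _ _ (fin_three_ne_add_two n).symm⟩
  rcases h.not_separated l with H | H
  · have hsub : convexHull ℝ (Set.range v) ⊆ f l ⁻¹' Set.Ioi 0 := by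
      apply convexHull_min _ ((convex_Ioi (0 : ℝ)).affine_preimage _)
      rintro _ ⟨n, rfl⟩
      exact (H n).lt_of_ne' (hv n)
    exact (hsub hy).ne'
  · have hsub : convexHull ℝ (Set.range v) ⊆ f l ⁻¹' Set.Iio 0 := by
      apply convexHull_min _ ((convex_Iio (0 : ℝ)).affine_preimage _)
      rintro _ ⟨n, rfl⟩
      exact (H n).lt_of_ne (hv n)
    exact (hsub hy).ne

/-- The closed triangle is the closure of its interior, so the vertices of any other description
`v'` of the same face lie in it. This makes the side lines independent of the chosen vertices. -/
theorem mem_range_of_zero_vertex (hA : IsSimple (zeroSets f)) (h : SpansFace f e v)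
    (hv' : AffineIndependent ℝ v')
    (heq : interior (convexHull ℝ (Set.range v)) = interior (convexHull ℝ (Set.range v')))
    {l : ι} {n : Fin 3} (hl : f l (v' n) = 0) : l ∈ Set.range e := by
  by_contra hne
  refine h.apply_ne_zero_of_mem_convexHull hA hne (y := v' n) ?_ hl
  rw [← closure_interior_convexHull h.affineIndependent, heq, closure_interior_convexHull hv']
  exact subset_convexHull ℝ _ ⟨n, rfl⟩

theorem range_eq (hA : IsSimple (zeroSets f)) (h : SpansFace f e v) (h' : SpansFace f e' v')
    (heq : interior (convexHull ℝ (Set.range v)) = interior (convexHull ℝ (Set.range v'))) :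
    Set.range e = Set.range e' := by
  apply Set.Subset.antisymm
  · rintro _ ⟨n, rfl⟩
    exact h'.mem_range_of_zero_vertex hA h.affineIndependent heq.symm
      (h.apply_of_ne n (n + 1) (fin_three_ne_add_one n))
  · rintro _ ⟨n, rfl⟩
    exact h.mem_range_of_zero_vertex hA h'.affineIndependent heq
      (h'.apply_of_ne n (n + 1) (fin_three_ne_add_one n))

theorem touches_iff (hA : IsSimple (zeroSets f)) (h : SpansFace f e v) (l : ι) :
    Touches (zeroSets f l) (interior (convexHull ℝ (Set.range v))) ↔ l ∈ Set.range e := by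
  constructor
  · rintro ⟨v', ⟨hv', heq⟩, i, j, -, hseg⟩
    exact h.mem_range_of_zero_vertex hA hv' heq (n := i) (hseg (left_mem_segment ℝ _ _))
  · rintro ⟨n, rfl⟩
    refine ⟨v, ⟨h.affineIndependent, rfl⟩, n + 1, n + 2, by simp, ?_⟩
    apply (((convex_singleton (0 : ℝ)).affine_preimage (f (e n)))).segment_subset
    · exact h.apply_of_ne _ _ (fin_three_ne_add_one n)
    · exact h.apply_of_ne _ _ (fin_three_ne_add_two n)

end SpansFace

/-- The midpoint of a side is not in the open cell, so some line function fails to be strictly of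
the right sign there. Both end points are weakly of the right sign, so that function vanishes at
both: its line carries the side. -/
theorem exists_spansFace {ι : Type*} {f : ι → ℝ × ℝ →ᵃ[ℝ] ℝ} {v : Fin 3 → ℝ × ℝ}
    (hv : AffineIndependent ℝ v)
    (hF : IsFace (zeroSets f) (interior (convexHull ℝ (Set.range v)))) :
    ∃ e, SpansFace f e v := by
  obtain ⟨x, hxU, hF⟩ := hF
  have hx := mem_compl_iUnion_zeroSets.1 hxU
  rw [connectedComponentIn_compl_zeroSets f hx] at hF
  have hcl : ∀ y ∈ convexHull ℝ (Set.range v), ∀ l, 0 ≤ f l x * f l y := by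
    intro y hy l
    rw [← closure_interior_convexHull hv, hF] at hy
    have hc : IsClosed {y | 0 ≤ f l x * f l y} :=
      isClosed_le continuous_const (continuous_const.mul (f l).continuous_of_finiteDimensional)
    exact closure_minimal (fun z hz => (hz l).le) hc hy
  have hvn : ∀ n l, 0 ≤ f l x * f l (v n) := fun n l =>
    hcl _ (subset_convexHull ℝ _ ⟨n, rfl⟩) l
  obtain ⟨b, rfl⟩ := exists_affineBasis hv
  have hexists : ∀ l, ∃ n, f l (b n) ≠ 0 := by
    intro l
    by_contra! H
    exact hx l (by rw [affine_apply_eq_sum_coord b (f l) x]; simp [H])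
  have hside : ∀ n, ∃ l, ∀ k, n ≠ k → f l (b k) = 0 := by
    intro n
    set w : ℝ × ℝ := midpoint ℝ (b (n + 1)) (b (n + 2)) with hw
    have hfw : ∀ g : ℝ × ℝ →ᵃ[ℝ] ℝ, g w = (g (b (n + 1)) + g (b (n + 2))) / 2 := by
      intro g
      rw [hw, AffineMap.map_midpoint, midpoint_eq_smul_add]
      simp; ring
    have hnot : w ∉ interior (convexHull ℝ (Set.range b)) := by
      rw [b.interior_convexHull]
      intro H
      have := H n
      rw [hfw, b.coord_apply, b.coord_apply, if_neg (fin_three_ne_add_one n),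
        if_neg (fin_three_ne_add_two n)] at this
      simp at this
    rw [hF] at hnot
    simp only [Set.mem_ofPred_eq, not_forall, not_lt] at hnot
    obtain ⟨l, hl⟩ := hnot
    refine ⟨l, ?_⟩
    rw [hfw] at hl
    have h1 := hvn (n + 1) l
    have h2 := hvn (n + 2) l
    have h3 : f l x * f l (b (n + 1)) = 0 := by linarith
    have h4 : f l x * f l (b (n + 2)) = 0 := by linarith
    have h5 := (mul_eq_zero.1 h3).resolve_left (hx l)
    have h6 := (mul_eq_zero.1 h4).resolve_left (hx l)
    intro k hk
    obtain rfl | rfl := fin_three_eq_add n k hk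
    · exact h5
    · exact h6
  choose e he using hside
  refine ⟨e, fun n => ?_, fun n k hnk => he n k hnk, hexists, fun l => ?_⟩
  · obtain ⟨k, hk⟩ := hexists (e n)
    by_cases hkn : n = k
    · exact hkn ▸ hk
    · exact absurd (he n k hkn) hk
  · rcases (hx l).lt_or_gt with h | h
    · right; intro n
      have := hvn n l
      by_contra! H
      nlinarith
    · left; intro n
      have := hvn n l
      by_contra! H
      nlinarith

/-! ### Triangular faces as increasing triples of lines -/

section Triples

variable {ι : Type*}

/-- The vertices of the triangle bounded by three lines, given the crossing points `P i j`. -/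
def tripleVertices (P : ι → ι → ℝ × ℝ) (t : ι × ι × ι) : Fin 3 → ℝ × ℝ :=
  ![P t.2.1 t.2.2, P t.1 t.2.2, P t.1 t.2.1]

/-- The open triangle bounded by three lines, given the crossing points `P i j`. -/
def tripleTriangle (P : ι → ι → ℝ × ℝ) (t : ι × ι × ι) : Set (ℝ × ℝ) :=
  interior (convexHull ℝ (Set.range (tripleVertices P t)))

/-- The increasing triples of lines that bound a triangular face. -/
def faceTriples [LinearOrder ι] (f : ι → ℝ × ℝ →ᵃ[ℝ] ℝ) (P : ι → ι → ℝ × ℝ) : Set (ι × ι × ι) :=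
  {t | t.1 < t.2.1 ∧ t.2.1 < t.2.2 ∧ SpansFace f ![t.1, t.2.1, t.2.2] (tripleVertices P t)}

variable [LinearOrder ι] {f : ι → ℝ × ℝ →ᵃ[ℝ] ℝ} {P : ι → ι → ℝ × ℝ}

theorem boundedTriangles_eq_image (hA : IsSimple (zeroSets f))
    (hP : ∀ i j, i ≠ j → f i (P i j) = 0 ∧ f j (P i j) = 0) :
    boundedTriangles (zeroSets f) = tripleTriangle P '' faceTriples f P := by
  apply Set.Subset.antisymm
  · rintro _ ⟨hF, -, v, hv, rfl⟩
    obtain ⟨e, he⟩ := exists_spansFace hv hF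
    -- Relabelling the sides in increasing order makes the triple canonical; uniqueness of crossings
    -- then identifies the vertices.
    set σ := Tuple.sort e
    have hmono : StrictMono (e ∘ σ) :=
      (Tuple.monotone_sort e).strictMono_of_injective (he.injective.comp σ.injective)
    have hs := he.comp σ
    generalize hev : e ∘ σ = e' at hmono hs
    generalize hvv : v ∘ σ = v' at hs
    have hrange : Set.range v = Set.range v' := by
      rw [← hvv, σ.surjective.range_comp]
    have huniq : ∀ n k l, n ≠ k → n ≠ l → k ≠ l → v' n = P (e' k) (e' l) := by
      intro n k l hnk hnl hkl
      exact (hA.cross (e' k) (e' l) (hs.injective.ne hkl)).unique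
        ⟨hs.apply_of_ne k n hnk.symm, hs.apply_of_ne l n hnl.symm⟩
        (hP _ _ (hs.injective.ne hkl))
    have hv' : v' = tripleVertices P (e' 0, e' 1, e' 2) := by
      funext n
      fin_cases n
      · exact huniq 0 1 2 (by decide) (by decide) (by decide)
      · exact huniq 1 0 2 (by decide) (by decide) (by decide)
      · exact huniq 2 0 1 (by decide) (by decide) (by decide)
    have he' : e' = ![e' 0, e' 1, e' 2] := by
      funext n; fin_cases n <;> rfl
    refine ⟨(e' 0, e' 1, e' 2), ⟨hmono (by decide), hmono (by decide), ?_⟩, ?_⟩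
    · rw [← hv']
      exact he' ▸ hs
    · rw [tripleTriangle, ← hv', hrange]
  · rintro _ ⟨t, ⟨-, -, ht⟩, rfl⟩
    exact ht.mem_boundedTriangles

theorem tripleTriangle_injOn (hA : IsSimple (zeroSets f)) :
    Set.InjOn (tripleTriangle P) (faceTriples f P) := by
  rintro ⟨i, j, k⟩ ⟨hij, hjk, h⟩ ⟨i', j', k'⟩ ⟨hij', hjk', h'⟩ heq
  have hr := h.range_eq hA h' heq
  have hm : StrictMono ![i, j, k] := by
    rw [Fin.strictMono_iff_lt_succ]; intro n; fin_cases n <;> assumption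
  have hm' : StrictMono ![i', j', k'] := by
    rw [Fin.strictMono_iff_lt_succ]; intro n; fin_cases n <;> assumption
  have := (hm.range_inj hm').1 hr
  have h0 := congrFun this 0
  have h1 := congrFun this 1
  have h2 := congrFun this 2
  simp at h0 h1 h2
  simp [h0, h1, h2]

theorem ncard_boundedTriangles (hA : IsSimple (zeroSets f))
    (hP : ∀ i j, i ≠ j → f i (P i j) = 0 ∧ f j (P i j) = 0) :
    (boundedTriangles (zeroSets f)).ncard = (faceTriples f P).ncard := by
  rw [boundedTriangles_eq_image hA hP, (tripleTriangle_injOn hA).ncard_image]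

theorem ncard_touchedTriangles (hA : IsSimple (zeroSets f))
    (hP : ∀ i j, i ≠ j → f i (P i j) = 0 ∧ f j (P i j) = 0) (l : ι) :
    (touchedTriangles (zeroSets f) l).ncard =
      {t ∈ faceTriples f P | l = t.1 ∨ l = t.2.1 ∨ l = t.2.2}.ncard := by
  have : touchedTriangles (zeroSets f) l =
      tripleTriangle P '' {t ∈ faceTriples f P | l = t.1 ∨ l = t.2.1 ∨ l = t.2.2} := by
    have key : ∀ t ∈ faceTriples f P,
        (Touches (zeroSets f l) (tripleTriangle P t) ↔ l = t.1 ∨ l = t.2.1 ∨ l = t.2.2) := by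
      rintro t ⟨-, -, ht⟩
      rw [tripleTriangle, ht.touches_iff hA]
      simp only [Set.mem_range, Fin.exists_fin_succ, Matrix.cons_val_zero, Matrix.cons_val_succ]
      simp [eq_comm]
    ext F
    rw [touchedTriangles, boundedTriangles_eq_image hA hP]
    constructor
    · rintro ⟨⟨t, ht, rfl⟩, h⟩
      exact ⟨t, ⟨ht, (key t ht).1 h⟩, rfl⟩
    · rintro ⟨t, ⟨ht, h⟩, rfl⟩
      exact ⟨⟨t, ht, rfl⟩, (key t ht).2 h⟩
  rw [this, ((tripleTriangle_injOn hA).mono (Set.sep_subset _ _)).ncard_image]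

end Triples

/-! ### Rational bounds for the tangents -/

/-- The sine is a root of `3 s - 4 s ^ 3 = 1 / 2`, by the triple angle formula. Since `0 < s < 1 /
2`, factoring a difference of values of this cubic shows on which side of each bound the root lies.
-/
theorem sin_pi_div_eighteen_bounds :
    Real.sin (Real.pi / 18) ∈ Set.Icc (0.173648 : ℝ) 0.173649 := by
  have hpi := Real.pi_pos
  have h3 : 3 * Real.sin (Real.pi / 18) - 4 * Real.sin (Real.pi / 18) ^ 3 = 1 / 2 := by
    rw [← Real.sin_three_mul, ← Real.sin_pi_div_six]; congr 1; ring
  have h0 : 0 < Real.sin (Real.pi / 18) := Real.sin_pos_of_pos_of_lt_pi (by linarith) (by linarith)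
  have h1 : Real.sin (Real.pi / 18) < 1 / 2 := by
    rw [← Real.sin_pi_div_six]
    exact Real.sin_lt_sin_of_lt_of_le_pi_div_two (by linarith) (by linarith) (by linarith)
  generalize Real.sin (Real.pi / 18) = s at *
  constructor
  · by_contra! h
    nlinarith [mul_pos (sub_pos.2 h)
      (show 0 < 3 - 4 * ((0.173648 : ℝ) ^ 2 + 0.173648 * s + s ^ 2) by nlinarith)]
  · by_contra! h
    nlinarith [mul_pos (sub_pos.2 h)
      (show 0 < 3 - 4 * ((0.173649 : ℝ) ^ 2 + 0.173649 * s + s ^ 2) by nlinarith)]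

theorem tan_pi_div_eighteen_bounds :
    Real.tan (1 * Real.pi / 18) ∈ Set.Icc (0.176325 : ℝ) 0.17633 := by
  have hpi := Real.pi_pos
  obtain ⟨hl, hu⟩ := sin_pi_div_eighteen_bounds
  have hc : 0 < Real.cos (Real.pi / 18) := Real.cos_pos_of_mem_Ioo ⟨by linarith, by linarith⟩
  have hsc := Real.sin_sq_add_cos_sq (Real.pi / 18)
  rw [one_mul, Real.tan_eq_sin_div_cos]
  generalize Real.sin (Real.pi / 18) = s at *
  generalize Real.cos (Real.pi / 18) = c at *
  constructor
  · rw [le_div_iff₀ hc]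
    refine le_of_sq_le_sq ?_ (by linarith)
    nlinarith
  · rw [div_le_iff₀ hc]
    refine le_of_sq_le_sq ?_ (by positivity)
    nlinarith

/-- `2 t / (1 - t ^ 2)` is increasing for `0 < t < 1`, so bounds at the end points suffice. -/
theorem double_tan_bounds {x lo hi lo' hi' : ℝ} (h : Real.tan x ∈ Set.Icc lo hi) (hlo : 0 < lo)
    (hhi : hi < 1) (h1 : lo' * (1 - lo ^ 2) ≤ 2 * lo) (h2 : 2 * hi ≤ hi' * (1 - hi ^ 2))
    (h3 : 0 ≤ lo') (h4 : 0 ≤ hi') : Real.tan (2 * x) ∈ Set.Icc lo' hi' := by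
  obtain ⟨hl, hu⟩ := h
  rw [Real.tan_two_mul]
  have hpos : 0 < 1 - Real.tan x ^ 2 := by nlinarith
  generalize Real.tan x = t at *
  have hlt : lo ^ 2 ≤ t ^ 2 := by gcongr
  have hth : t ^ 2 ≤ hi ^ 2 := by gcongr; linarith
  constructor
  · rw [le_div_iff₀ hpos]; nlinarith
  · rw [div_le_iff₀ hpos]; nlinarith

theorem complementary_tan_bounds {x y lo hi lo' hi' : ℝ} (h : Real.tan x ∈ Set.Icc lo hi)
    (hxy : y = Real.pi / 2 - x) (hlo : 0 < lo) (h1 : lo' * hi ≤ 1) (h2 : 1 ≤ hi' * lo)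
    (h3 : 0 ≤ lo') : Real.tan y ∈ Set.Icc lo' hi' := by
  obtain ⟨hl, hu⟩ := h
  rw [hxy, Real.tan_pi_div_two_sub]
  generalize Real.tan x = t at *
  have ht : 0 < t := by linarith
  rw [inv_eq_one_div]
  constructor
  · rw [le_div_iff₀ ht]; nlinarith
  · rw [div_le_iff₀ ht]; nlinarith

theorem tan_two_pi_div_eighteen_bounds :
    Real.tan (2 * Real.pi / 18) ∈ Set.Icc (0.36396 : ℝ) 0.36398 := by
  rw [show 2 * Real.pi / 18 = 2 * (1 * Real.pi / 18) by ring]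
  apply double_tan_bounds tan_pi_div_eighteen_bounds <;> norm_num

theorem tan_three_pi_div_eighteen_bounds :
    Real.tan (3 * Real.pi / 18) ∈ Set.Icc (0.57735 : ℝ) 0.57736 := by
  rw [show 3 * Real.pi / 18 = Real.pi / 6 by ring, Real.tan_pi_div_six]
  constructor
  · rw [le_div_iff₀ (by positivity), ← le_div_iff₀' (by norm_num)]
    exact Real.sqrt_le_iff.2 ⟨by norm_num, by norm_num⟩
  · rw [div_le_iff₀ (by positivity), ← div_le_iff₀' (by norm_num)]
    exact Real.le_sqrt_of_sq_le (by norm_num)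

theorem tan_four_pi_div_eighteen_bounds :
    Real.tan (4 * Real.pi / 18) ∈ Set.Icc (0.83906 : ℝ) 0.83914 := by
  rw [show 4 * Real.pi / 18 = 2 * (2 * Real.pi / 18) by ring]
  apply double_tan_bounds tan_two_pi_div_eighteen_bounds <;> norm_num

theorem tan_five_pi_div_eighteen_bounds :
    Real.tan (5 * Real.pi / 18) ∈ Set.Icc (1.19169 : ℝ) 1.19182 :=
  complementary_tan_bounds tan_four_pi_div_eighteen_bounds (by ring) (by norm_num) (by norm_num)
    (by norm_num) (by norm_num)

theorem tan_six_pi_div_eighteen_bounds :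
    Real.tan (6 * Real.pi / 18) ∈ Set.Icc (1.73200 : ℝ) 1.73210 :=
  complementary_tan_bounds tan_three_pi_div_eighteen_bounds (by ring) (by norm_num) (by norm_num)
    (by norm_num) (by norm_num)

theorem tan_seven_pi_div_eighteen_bounds :
    Real.tan (7 * Real.pi / 18) ∈ Set.Icc (2.74740 : ℝ) 2.74756 :=
  complementary_tan_bounds tan_two_pi_div_eighteen_bounds (by ring) (by norm_num) (by norm_num)
    (by norm_num) (by norm_num)

theorem tan_eight_pi_div_eighteen_bounds :
    Real.tan (8 * Real.pi / 18) ∈ Set.Icc (5.67117 : ℝ) 5.67135 :=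
  complementary_tan_bounds tan_pi_div_eighteen_bounds (by ring) (by norm_num) (by norm_num)
    (by norm_num) (by norm_num)

/-! ### Integer interval arithmetic -/

/-- The real number `x` lies in the interval with the integer end points `p.1` and `p.2`. -/
def InInterval (p : ℤ × ℤ) (x : ℝ) : Prop := (p.1 : ℝ) ≤ x ∧ x ≤ p.2

/-- The difference of two intervals. -/
def intervalSub (p q : ℤ × ℤ) : ℤ × ℤ := (p.1 - q.2, p.2 - q.1)

/-- The sum of two intervals. -/
def intervalAdd (p q : ℤ × ℤ) : ℤ × ℤ := (p.1 + q.1, p.2 + q.2)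

/-- The product of two intervals. -/
def intervalMul (p q : ℤ × ℤ) : ℤ × ℤ :=
  (min (min (p.1 * q.1) (p.1 * q.2)) (min (p.2 * q.1) (p.2 * q.2)),
    max (max (p.1 * q.1) (p.1 * q.2)) (max (p.2 * q.1) (p.2 * q.2)))

theorem InInterval.sub {p q : ℤ × ℤ} {x y : ℝ} (hx : InInterval p x) (hy : InInterval q y) :
    InInterval (intervalSub p q) (x - y) := by
  obtain ⟨h1, h2⟩ := hx
  obtain ⟨h3, h4⟩ := hy
  constructor <;> simp only [intervalSub] <;> push_cast <;> linarith

theorem InInterval.add {p q : ℤ × ℤ} {x y : ℝ} (hx : InInterval p x) (hy : InInterval q y) :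
    InInterval (intervalAdd p q) (x + y) := by
  obtain ⟨h1, h2⟩ := hx
  obtain ⟨h3, h4⟩ := hy
  constructor <;> simp only [intervalAdd] <;> push_cast <;> linarith

theorem InInterval.mul {p q : ℤ × ℤ} {x y : ℝ} (hx : InInterval p x) (hy : InInterval q y) :
    InInterval (intervalMul p q) (x * y) := by
  obtain ⟨h1, h2⟩ := hx
  obtain ⟨h3, h4⟩ := hy
  constructor <;> simp only [intervalMul] <;> push_cast
  -- The product is linear in each factor: the sign of `y` selects the extreme end point for `x`,
  -- whose sign then selects the one for `y`.
  · rcases le_total 0 y with hy0 | hy0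
    · refine le_trans ?_ (mul_le_mul_of_nonneg_right h1 hy0)
      rcases le_total 0 (p.1 : ℝ) with hp | hp
      · exact (min_le_left _ _).trans ((min_le_left _ _).trans (mul_le_mul_of_nonneg_left h3 hp))
      · exact (min_le_left _ _).trans ((min_le_right _ _).trans (mul_le_mul_of_nonpos_left h4 hp))
    · refine le_trans ?_ (mul_le_mul_of_nonpos_right h2 hy0)
      rcases le_total 0 (p.2 : ℝ) with hp | hp
      · exact (min_le_right _ _).trans ((min_le_left _ _).trans (mul_le_mul_of_nonneg_left h3 hp))
      · exact (min_le_right _ _).trans ((min_le_right _ _).trans (mul_le_mul_of_nonpos_left h4 hp))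
  · rcases le_total 0 y with hy0 | hy0
    · refine (mul_le_mul_of_nonneg_right h2 hy0).trans ?_
      rcases le_total 0 (p.2 : ℝ) with hp | hp
      · exact (mul_le_mul_of_nonneg_left h4 hp).trans ((le_max_right _ _).trans (le_max_right _ _))
      · exact (mul_le_mul_of_nonpos_left h3 hp).trans ((le_max_left _ _).trans (le_max_right _ _))
    · refine (mul_le_mul_of_nonpos_right h1 hy0).trans ?_
      rcases le_total 0 (p.1 : ℝ) with hp | hp
      · exact (mul_le_mul_of_nonneg_left h4 hp).trans ((le_max_right _ _).trans (le_max_left _ _))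
      · exact (mul_le_mul_of_nonpos_left h3 hp).trans ((le_max_left _ _).trans (le_max_left _ _))

/-! ### Numerical data and finite checks -/

/-- The determinant whose sign is the orientation of the triple of lines `y = μ i * (x - α i)`. -/
def tripleDet (μ α : ℕ → ℝ) (i j k : ℕ) : ℝ :=
  μ j * μ k * (α k - α j) - μ i * μ k * (α k - α i) + μ i * μ j * (α j - α i)

/-- Bounds, in units of `10⁻⁵`, for the slopes of the lines of the base configuration. Number `0` is
the line `Y₀`, and number `19` is the sweep line. -/
def slopeInterval (i : ℕ) : ℤ × ℤ :=
  [(0, 0), (-18016, -17996), (-25241, -25221), (-32594, -32574), (-174531, -174511),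
    (-217951, -217931), (-279567, -279547), (-459596, -459576), (-567213, -567193),
    (-739915, -739895), (-2307902, -2307882), (438995, 439015), (290194, 290214),
    (131835, 131855), (90182, 90202), (84491, 84511), (64058, 64078), (44383, 44403),
    (15538, 15558), (10000, 10000)].getD i (0, 0)

/-- Bounds, in units of `10⁻⁵`, for the intercepts of the lines of the base configuration. Number
`0` is the line `Y₀`, and number `19` is the sweep line. -/
def interceptInterval (i : ℕ) : ℤ × ℤ :=
  [(0, 0), (-567135, -567117), (-83914, -83906), (-173210, -173200), (274740, 274756),
    (17632, 17633), (119169, 119182), (-119182, -119169), (-10, 0), (-36398, -36396),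
    (57735, 57736), (-274756, -274740), (-57736, -57735), (36396, 36398), (83906, 83914), (0, 10),
    (173200, 173210), (-17633, -17632), (567117, 567135),
    (-100000000000, -100000000000)].getD i (0, 0)

/-- An interval that contains the orientation determinant of three lines. -/
def detInterval (i j k : ℕ) : ℤ × ℤ :=
  let mi := slopeInterval i
  let mj := slopeInterval j
  let mk := slopeInterval k
  let ai := interceptInterval i
  let aj := interceptInterval j
  let ak := interceptInterval k
  intervalAdd
    (intervalSub (intervalMul (intervalMul mj mk) (intervalSub ak aj))
      (intervalMul (intervalMul mi mk) (intervalSub ak ai)))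
    (intervalMul (intervalMul mi mj) (intervalSub aj ai))

/-- The approximate slopes of the lines, in units of `10⁻⁵`. -/
def approxSlope (i : ℕ) : ℤ :=
  [0, -18006, -25231, -32584, -174521, -217941, -279557, -459586, -567203, -739905, -2307892,
    439005, 290204, 131845, 90192, 84501, 64068, 44393, 15548, 10000].getD i 0

/-- The approximate `y`-intercepts of the lines, in units of `10⁻⁵`. -/
def approxHeight (i : ℕ) : ℤ :=
  -- These are the heights `-m a` at the slope centers, with the sample value `ε = 5 * 10⁻⁵` for the
  -- entries `-28` and `-4`.
  [0, -102117, -21171, -56437, 479493, 38429, 333163, -547713, -28, -269303, 1332462, 1206156,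
    167549, -47988, -75680, -4, -110969, 7828, -88177, 10000000000].getD i 0

/-- An integer that has the sign of the orientation determinant of three lines. -/
def approxDet (i j k : ℕ) : ℤ :=
  (approxSlope k - approxSlope i) * (approxHeight j - approxHeight i) -
    (approxSlope j - approxSlope i) * (approxHeight k - approxHeight i)

/-- The line number `i` has a smaller slope than the line number `j`. -/
def slopeLt (i j : ℕ) : Bool := decide (approxSlope i < approxSlope j)

/-- The crossing point of the lines number `i` and `j` lies above the line number `l`. -/
def isAbove (l i j : ℕ) : Bool := decide (0 < approxDet i j l) == slopeLt i j

/-- The signs of the orientation determinants of three lines agree with the approximate ones. -/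
def detCheck : Bool :=
  (List.range 20).all fun k => (List.range k).all fun j => (List.range j).all fun i =>
    let d := detInterval i j k
    (decide (0 < d.1) && decide (0 < approxDet i j k)) ||
    (decide (d.2 < 0) && decide (approxDet i j k < 0)) || (i == 0 && j == 8 && k == 15)

/-- The triple `0, 8, 15` is exempt: the intercept intervals of `L₈` and `L₁₅` meet at `0`, so the
bounds cannot exclude a zero determinant. -/
theorem detCheck_eq_true : detCheck = true := by decide +kernel

/-- The slope intervals are disjoint, and ordered like the approximate slopes. -/
def slopeCheck : Bool :=
  (List.range 20).all fun i => (List.range 20).all fun j => i == j ||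
    (if slopeLt i j then decide ((slopeInterval i).2 < (slopeInterval j).1)
    else decide ((slopeInterval j).2 < (slopeInterval i).1))

theorem slopeCheck_eq_true : slopeCheck = true := by decide +kernel

/-- No line of the base configuration separates the crossing points of the three lines of `t`. -/
def isFaceTriple (t : Fin 19 × Fin 19 × Fin 19) : Bool :=
  decide (t.1 < t.2.1) && (decide (t.2.1 < t.2.2) && (List.finRange 19).all fun l =>
    l == t.1 || l == t.2.1 || l == t.2.2 ||
      (isAbove l t.1 t.2.1 == isAbove l t.1 t.2.2 && isAbove l t.1 t.2.1 == isAbove l t.2.1 t.2.2))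

theorem card_isFaceTriple :
    (Finset.univ.filter fun t : Fin 19 × Fin 19 × Fin 19 => isFaceTriple t = true).card = 107 := by
  decide +kernel

theorem card_isFaceTriple_zero :
    (Finset.univ.filter fun p : Fin 19 × Fin 19 => isFaceTriple (0, p) = true).card = 17 := by
  decide +kernel

/-- The rows of the order matrix are injective and do not contain their own number, and the crossing
points on each line are ordered as in the order matrix. -/
def orderCheck : Bool :=
  (List.finRange 19).all fun i => (List.finRange 18).all fun l =>
    (baseOMatrix i l != i) && (List.finRange 18).all fun k => !decide (k < l) ||
      (baseOMatrix i k != baseOMatrix i l &&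
        ((slopeLt i 19 ^^ isAbove (baseOMatrix i l) i (baseOMatrix i k)) ^^
          slopeLt i (baseOMatrix i l)))

theorem orderCheck_eq_true : orderCheck = true := by decide +kernel

/-- The crossing points lie below the sweep line, which meets the lines in their order. -/
def sweepCheck : Bool :=
  (List.finRange 19).all fun i => (List.finRange 19).all fun j =>
    i == j || (!isAbove 19 i j && (!decide (i < j) || (isAbove j i 19 == slopeLt 19 j)))

theorem sweepCheck_eq_true : sweepCheck = true := by decide +kernel

/-! ### Affine forms and crossing points -/

/-- The affine function `y - μ * (x - α)`, which vanishes on the line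
`y = μ * (x - α)` and is positive above it. -/
noncomputable def lineForm (μ α : ℝ) : ℝ × ℝ →ᵃ[ℝ] ℝ :=
  (LinearMap.snd ℝ ℝ ℝ - μ • LinearMap.fst ℝ ℝ ℝ).toAffineMap + AffineMap.const ℝ (ℝ × ℝ) (μ * α)

@[simp]
theorem lineForm_apply (μ α : ℝ) (p : ℝ × ℝ) : lineForm μ α p = p.2 - μ * (p.1 - α) := by
  simp [lineForm]; ring

/-- The crossing point of the lines number `i` and `j`. -/
noncomputable def crossing (μ α : ℕ → ℝ) (i j : ℕ) : ℝ × ℝ :=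
  ((μ i * α i - μ j * α j) / (μ i - μ j), μ i * ((μ i * α i - μ j * α j) / (μ i - μ j) - α i))

section Crossing

variable {μ α : ℕ → ℝ} {i j l : ℕ}

theorem lineForm_crossing_left : lineForm (μ i) (α i) (crossing μ α i j) = 0 := by
  simp [crossing]

theorem lineForm_crossing_right (h : μ i ≠ μ j) :
    lineForm (μ j) (α j) (crossing μ α i j) = 0 := by
  have := sub_ne_zero.2 h
  simp only [lineForm_apply, crossing]
  field_simp
  ring

theorem lineForm_crossing_mul (h : μ i ≠ μ j) :
    lineForm (μ l) (α l) (crossing μ α i j) * (μ i - μ j) = -tripleDet μ α i j l := by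
  have := sub_ne_zero.2 h
  simp only [lineForm_apply, crossing, tripleDet]
  field_simp
  ring

theorem eq_crossing (h : μ i ≠ μ j) {p : ℝ × ℝ} (hi : lineForm (μ i) (α i) p = 0)
    (hj : lineForm (μ j) (α j) p = 0) : p = crossing μ α i j := by
  have hne := sub_ne_zero.2 h
  simp only [lineForm_apply] at hi hj
  have h1 : p.1 = (μ i * α i - μ j * α j) / (μ i - μ j) := by
    rw [eq_div_iff hne]; linarith
  refine Prod.ext h1 ?_
  simp only [crossing, ← h1]
  linarith

end Crossing

theorem tripleDet_swap_left (μ α : ℕ → ℝ) (i j k : ℕ) :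
    tripleDet μ α j i k = -tripleDet μ α i j k := by
  simp only [tripleDet]; ring

theorem tripleDet_swap_right (μ α : ℕ → ℝ) (i j k : ℕ) :
    tripleDet μ α i k j = -tripleDet μ α i j k := by
  simp only [tripleDet]; ring

theorem approxDet_swap_left (i j k : ℕ) : approxDet j i k = -approxDet i j k := by
  simp only [approxDet]; ring

theorem approxDet_swap_right (i j k : ℕ) : approxDet i k j = -approxDet i j k := by
  simp only [approxDet]; ring

/-! ### Transfer of signs from the sample to the actual lines -/

/-- Slopes and intercepts of `20` lines that are close to those of the base configuration. -/
structure IsNearBase (μ α : ℕ → ℝ) : Prop where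
  slope_mem : ∀ i < 20, InInterval (slopeInterval i) (100000 * μ i)
  intercept_mem : ∀ i < 20, InInterval (interceptInterval i) (100000 * α i)
  slope_zero : μ 0 = 0
  intercept_lt : α 8 < α 15

namespace IsNearBase

variable {μ α : ℕ → ℝ}

theorem slope_lt (h : IsNearBase μ α) {i j : ℕ} (hi : i < 20) (hj : j < 20) (hij : i ≠ j) :
    if slopeLt i j then μ i < μ j else μ j < μ i := by
  have hc := slopeCheck_eq_true
  simp only [slopeCheck, List.all_eq_true, List.mem_range, Bool.or_eq_true, beq_iff_eq] at hc
  have := (hc i hi j hj).resolve_left hij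
  have hmi := h.slope_mem i hi
  have hmj := h.slope_mem j hj
  obtain ⟨h1, h2⟩ := hmi
  obtain ⟨h3, h4⟩ := hmj
  split_ifs at this ⊢ with hlt
  · have h5 : ((slopeInterval i).2 : ℝ) < (slopeInterval j).1 := by
      exact_mod_cast of_decide_eq_true this
    linarith
  · have h5 : ((slopeInterval j).2 : ℝ) < (slopeInterval i).1 := by
      exact_mod_cast of_decide_eq_true this
    linarith

theorem slope_ne (h : IsNearBase μ α) {i j : ℕ} (hi : i < 20) (hj : j < 20) (hij : i ≠ j) :
    μ i ≠ μ j := by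
  have := h.slope_lt hi hj hij
  split_ifs at this
  · exact this.ne
  · exact this.ne'

theorem det_mem (h : IsNearBase μ α) {i j k : ℕ} (hi : i < 20) (hj : j < 20) (hk : k < 20) :
    InInterval (detInterval i j k) (100000 ^ 3 * tripleDet μ α i j k) := by
  have mi := h.slope_mem i hi
  have mj := h.slope_mem j hj
  have mk := h.slope_mem k hk
  have ai := h.intercept_mem i hi
  have aj := h.intercept_mem j hj
  have ak := h.intercept_mem k hk
  -- Each term is a product of two slopes and one intercept, hence the cubed unit.
  rw [show 100000 ^ 3 * tripleDet μ α i j k =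
    100000 * μ j * (100000 * μ k) * (100000 * α k - 100000 * α j) -
    100000 * μ i * (100000 * μ k) * (100000 * α k - 100000 * α i) +
    100000 * μ i * (100000 * μ j) * (100000 * α j - 100000 * α i) by
      simp only [tripleDet]; ring]
  exact (((mj.mul mk).mul (ak.sub aj)).sub ((mi.mul mk).mul (ak.sub ai))).add
    ((mi.mul mj).mul (aj.sub ai))

theorem approxDet_mul_pos_of_lt (h : IsNearBase μ α) {i j k : ℕ} (hij : i < j) (hjk : j < k)
    (hk : k < 20) : 0 < (approxDet i j k : ℝ) * tripleDet μ α i j k := by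
  have hc := detCheck_eq_true
  simp only [detCheck, List.all_eq_true, List.mem_range, Bool.or_eq_true, Bool.and_eq_true,
    beq_iff_eq, decide_eq_true_eq] at hc
  obtain ⟨hl, hu⟩ := h.det_mem (hij.trans (hjk.trans hk)) (hjk.trans hk) hk
  rcases hc k hk j hjk i hij with (⟨h1, h2⟩ | ⟨h1, h2⟩) | ⟨⟨rfl, rfl⟩, rfl⟩
  · have h1' : (0 : ℝ) < (detInterval i j k).1 := by exact_mod_cast h1
    have h2' : (0 : ℝ) < approxDet i j k := by exact_mod_cast h2
    exact mul_pos h2' (by linarith)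
  · have h1' : ((detInterval i j k).2 : ℝ) < 0 := by exact_mod_cast h1
    have h2' : (approxDet i j k : ℝ) < 0 := by exact_mod_cast h2
    exact mul_pos_of_neg_of_neg h2' (by linarith)
  -- Since `μ 0 = 0`, this determinant is `μ 8 * μ 15 * (α 15 - α 8)`, negative because the two
  -- slopes have opposite signs.
  · have h2 : approxDet 0 8 15 < 0 := by decide
    have h2' : (approxDet 0 8 15 : ℝ) < 0 := by exact_mod_cast h2
    apply mul_pos_of_neg_of_neg h2'
    have h8 : μ 8 < μ 0 := h.slope_lt (i := 8) (j := 0) (by simp) (by simp) (by simp)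
    have h15 : μ 0 < μ 15 := h.slope_lt (i := 0) (j := 15) (by simp) (by simp) (by simp)
    have ha := h.intercept_lt
    simp only [tripleDet]
    rw [h.slope_zero] at h8 h15 ⊢
    nlinarith [mul_neg_of_neg_of_pos (mul_neg_of_neg_of_pos h8 h15) (sub_pos.2 ha)]

/-- Both determinants are alternating, so their product is symmetric and the increasing triples
suffice. -/
theorem approxDet_mul_pos (h : IsNearBase μ α) {i j k : ℕ} (hi : i < 20) (hj : j < 20) (hk : k < 20)
    (hij : i ≠ j) (hik : i ≠ k) (hjk : j ≠ k) :
    0 < (approxDet i j k : ℝ) * tripleDet μ α i j k := by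
  have hleft : ∀ i j k, (approxDet j i k : ℝ) * tripleDet μ α j i k =
      approxDet i j k * tripleDet μ α i j k := fun i j k => by
    rw [approxDet_swap_left, tripleDet_swap_left]; push_cast; ring
  have hright : ∀ i j k, (approxDet i k j : ℝ) * tripleDet μ α i k j =
      approxDet i j k * tripleDet μ α i j k := fun i j k => by
    rw [approxDet_swap_right, tripleDet_swap_right]; push_cast; ring
  rcases hij.lt_or_gt with h1 | h1 <;> rcases hjk.lt_or_gt with h2 | h2 <;>
    rcases hik.lt_or_gt with h3 | h3
  · exact h.approxDet_mul_pos_of_lt h1 h2 hk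
  · omega
  · rw [← hright]; exact h.approxDet_mul_pos_of_lt h3 h2 hj
  · rw [← hright, ← hleft]; exact h.approxDet_mul_pos_of_lt h3 h1 hj
  · rw [← hleft]; exact h.approxDet_mul_pos_of_lt h1 h3 hk
  · rw [← hleft, ← hright]; exact h.approxDet_mul_pos_of_lt h2 h3 hi
  · omega
  · rw [← hleft, ← hright, ← hleft]; exact h.approxDet_mul_pos_of_lt h2 h1 hi

theorem isAbove_spec (h : IsNearBase μ α) {l i j : ℕ} (hl : l < 20) (hi : i < 20) (hj : j < 20)
    (hij : i ≠ j) (hil : i ≠ l) (hjl : j ≠ l) :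
    if isAbove l i j then 0 < lineForm (μ l) (α l) (crossing μ α i j)
    else lineForm (μ l) (α l) (crossing μ α i j) < 0 := by
  have h1 := h.approxDet_mul_pos hi hj hl hij hil hjl
  have h2 := h.slope_lt hi hj hij
  have h3 := lineForm_crossing_mul (α := α) (l := l) (h.slope_ne hi hj hij)
  generalize lineForm (μ l) (α l) (crossing μ α i j) = y at *
  unfold isAbove
  by_cases h4 : 0 < approxDet i j l
  · have h4' : (0 : ℝ) < approxDet i j l := by exact_mod_cast h4
    have h5 := pos_of_mul_pos_right h1 h4'.le
    cases hs : slopeLt i j <;> simp [h4, hs] at h2 ⊢ <;> nlinarith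
  · have h4' : (approxDet i j l : ℝ) ≤ 0 := by exact_mod_cast not_lt.1 h4
    have h5 : tripleDet μ α i j l < 0 := by
      by_contra! h6
      nlinarith
    cases hs : slopeLt i j <;> simp [h4, hs] at h2 ⊢ <;> nlinarith

theorem lineForm_crossing_ne_zero (h : IsNearBase μ α) {l i j : ℕ} (hl : l < 20) (hi : i < 20)
    (hj : j < 20) (hij : i ≠ j) (hil : i ≠ l) (hjl : j ≠ l) :
    lineForm (μ l) (α l) (crossing μ α i j) ≠ 0 := by
  have := h.isAbove_spec hl hi hj hij hil hjl
  split_ifs at this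
  · exact this.ne'
  · exact this.ne

end IsNearBase

/-- The lines number `0, ..., 18` with the given slopes and intercepts. -/
noncomputable def lineForms (μ α : ℕ → ℝ) (i : Fin 19) : ℝ × ℝ →ᵃ[ℝ] ℝ := lineForm (μ i) (α i)

/-- The crossing points of the lines number `0, ..., 18`. -/
noncomputable def crossings (μ α : ℕ → ℝ) (i j : Fin 19) : ℝ × ℝ := crossing μ α i j

theorem val_lt_twenty (i : Fin 19) : (i : ℕ) < 20 := i.isLt.trans (by norm_num)

namespace IsNearBase

variable {μ α : ℕ → ℝ}

theorem lineForms_crossings (h : IsNearBase μ α) (i j : Fin 19) (hij : i ≠ j) :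
    lineForms μ α i (crossings μ α i j) = 0 ∧ lineForms μ α j (crossings μ α i j) = 0 :=
  ⟨lineForm_crossing_left, lineForm_crossing_right
    (h.slope_ne (val_lt_twenty i) (val_lt_twenty j) (Fin.val_ne_of_ne hij))⟩

theorem eq_crossings (h : IsNearBase μ α) {i j : Fin 19} (hij : i ≠ j) {p : ℝ × ℝ}
    (hi : p ∈ zeroSets (lineForms μ α) i) (hj : p ∈ zeroSets (lineForms μ α) j) :
    p = crossings μ α i j :=
  eq_crossing (h.slope_ne (val_lt_twenty i) (val_lt_twenty j) (Fin.val_ne_of_ne hij)) hi hj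

theorem isSimple (h : IsNearBase μ α) : IsSimple (zeroSets (lineForms μ α)) where
  isLine i := by
    refine ⟨-μ i, 1, -(μ i * α i), Or.inr one_ne_zero, ?_⟩
    ext p
    simp only [zeroSets, lineForms, lineForm_apply, Set.mem_ofPred_eq]
    constructor <;> intro H <;> linarith
  cross i j hij :=
    ⟨crossings μ α i j, h.lineForms_crossings i j hij, fun _ hp => h.eq_crossings hij hp.1 hp.2⟩
  noTriple i j k hij hik hjk := by
    rintro ⟨p, hi, hj, hk⟩
    obtain rfl := h.eq_crossings hij hi hj
    exact h.lineForm_crossing_ne_zero (val_lt_twenty k) (val_lt_twenty i) (val_lt_twenty j)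
      (Fin.val_ne_of_ne hij) (Fin.val_ne_of_ne hik) (Fin.val_ne_of_ne hjk) hk

theorem spansFace_iff (h : IsNearBase μ α) {i j k : Fin 19} (hij : i < j) (hjk : j < k) :
    SpansFace (lineForms μ α) ![i, j, k] (tripleVertices (crossings μ α) (i, j, k)) ↔
      ∀ l : Fin 19, l = i ∨ l = j ∨ l = k ∨
        (isAbove l i j = isAbove l i k ∧ isAbove l i j = isAbove l j k) := by
  have hij' := Fin.val_ne_of_ne hij.ne
  have hjk' := Fin.val_ne_of_ne hjk.ne
  have hik' := Fin.val_ne_of_ne (hij.trans hjk).ne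
  have Pij := h.lineForms_crossings i j hij.ne
  have Pjk := h.lineForms_crossings j k hjk.ne
  have Pik := h.lineForms_crossings i k (hij.trans hjk).ne
  have hi := val_lt_twenty i
  have hj := val_lt_twenty j
  have hk := val_lt_twenty k
  have Ni : lineForms μ α i (crossings μ α j k) ≠ 0 :=
    h.lineForm_crossing_ne_zero hi hj hk hjk' hij'.symm hik'.symm
  have Nj : lineForms μ α j (crossings μ α i k) ≠ 0 :=
    h.lineForm_crossing_ne_zero hj hi hk hik' hij' hjk'.symm
  have Nk : lineForms μ α k (crossings μ α i j) ≠ 0 :=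
    h.lineForm_crossing_ne_zero hk hi hj hij' hik' hjk'
  constructor
  · intro hs l
    by_cases hli : l = i; · exact Or.inl hli
    by_cases hlj : l = j; · exact Or.inr (Or.inl hlj)
    by_cases hlk : l = k; · exact Or.inr (Or.inr (Or.inl hlk))
    refine Or.inr (Or.inr (Or.inr ?_))
    have hl := val_lt_twenty l
    have hil' := Fin.val_ne_of_ne (Ne.symm hli)
    have hjl' := Fin.val_ne_of_ne (Ne.symm hlj)
    have hkl' := Fin.val_ne_of_ne (Ne.symm hlk)
    have A1 := h.isAbove_spec hl hi hj hij' hil' hjl'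
    have A2 := h.isAbove_spec hl hi hk hik' hil' hkl'
    have A3 := h.isAbove_spec hl hj hk hjk' hjl' hkl'
    have hsep := hs.not_separated l
    simp only [Fin.forall_fin_succ, tripleVertices, lineForms, crossings] at hsep
    simp at hsep
    simp only [lineForm_apply] at A1 A2 A3
    cases h1 : isAbove l i j <;> cases h2 : isAbove l i k <;> cases h3 : isAbove l j k <;>
      simp [h1, h2, h3] at A1 A2 A3 ⊢ <;> rcases hsep with ⟨_, _, _⟩ | ⟨_, _, _⟩ <;> linarith
  · intro hall
    refine ⟨fun n => ?_, fun n n' hn => ?_, fun l => ?_, fun l => ?_⟩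
    · fin_cases n
      · exact Ni
      · exact Nj
      · exact Nk
    · fin_cases n <;> fin_cases n' <;> first | exact absurd rfl hn | skip
      · exact Pik.1
      · exact Pij.1
      · exact Pjk.1
      · exact Pij.2
      · exact Pjk.2
      · exact Pik.2
    · by_cases hli : l = i; · exact ⟨0, hli ▸ Ni⟩
      by_cases hlj : l = j; · exact ⟨1, hlj ▸ Nj⟩
      exact ⟨2, h.lineForm_crossing_ne_zero (val_lt_twenty l) hi hj hij'
        (Fin.val_ne_of_ne (Ne.symm hli)) (Fin.val_ne_of_ne (Ne.symm hlj))⟩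
    · have H : ∀ v : Fin 3 → ℝ, (0 ≤ v 0 ∧ 0 ≤ v 1 ∧ 0 ≤ v 2) ∨ (v 0 ≤ 0 ∧ v 1 ≤ 0 ∧ v 2 ≤ 0) →
          (∀ n, 0 ≤ v n) ∨ (∀ n, v n ≤ 0) := fun v => by
        simp [Fin.forall_fin_succ]
      apply H fun n => lineForms μ α l (tripleVertices (crossings μ α) (i, j, k) n)
      change (0 ≤ lineForms μ α l (crossings μ α j k) ∧ 0 ≤ lineForms μ α l (crossings μ α i k) ∧
        0 ≤ lineForms μ α l (crossings μ α i j)) ∨ (lineForms μ α l (crossings μ α j k) ≤ 0 ∧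
        lineForms μ α l (crossings μ α i k) ≤ 0 ∧ lineForms μ α l (crossings μ α i j) ≤ 0)
      by_cases hli : l = i
      · subst hli
        rw [Pij.1, Pik.1]
        simpa using le_total _ _
      by_cases hlj : l = j
      · subst hlj
        rw [Pij.2, Pjk.1]
        simpa using le_total _ _
      by_cases hlk : l = k
      · subst hlk
        rw [Pik.2, Pjk.2]
        simpa using le_total _ _
      have hl := val_lt_twenty l
      have hil' := Fin.val_ne_of_ne (Ne.symm hli)
      have hjl' := Fin.val_ne_of_ne (Ne.symm hlj)
      have hkl' := Fin.val_ne_of_ne (Ne.symm hlk)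
      have A1 := h.isAbove_spec hl hi hj hij' hil' hjl'
      have A2 := h.isAbove_spec hl hi hk hik' hil' hkl'
      have A3 := h.isAbove_spec hl hj hk hjk' hjl' hkl'
      obtain ⟨E2, E3⟩ := (((hall l).resolve_left hli).resolve_left hlj).resolve_left hlk
      rw [← E2] at A2
      rw [← E3] at A3
      split_ifs at A1 A2 A3
      · exact Or.inl ⟨A3.le, A2.le, A1.le⟩
      · exact Or.inr ⟨A3.le, A2.le, A1.le⟩

theorem faceTriples_eq (h : IsNearBase μ α) :
    faceTriples (lineForms μ α) (crossings μ α) = {t | isFaceTriple t = true} := by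
  ext ⟨i, j, k⟩
  simp only [faceTriples, isFaceTriple, Set.mem_ofPred_eq, Bool.and_eq_true, decide_eq_true_eq,
    List.all_eq_true, List.mem_finRange, true_implies, Bool.or_eq_true, beq_iff_eq, or_assoc]
  constructor
  · rintro ⟨hij, hjk, H⟩
    exact ⟨hij, hjk, (h.spansFace_iff hij hjk).1 H⟩
  · rintro ⟨hij, hjk, H⟩
    exact ⟨hij, hjk, (h.spansFace_iff hij hjk).2 H⟩

theorem ncard_boundedTriangles (h : IsNearBase μ α) :
    (boundedTriangles (zeroSets (lineForms μ α))).ncard = 107 := by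
  rw [LineArrangement.ncard_boundedTriangles h.isSimple h.lineForms_crossings, h.faceTriples_eq,
    ← card_isFaceTriple, ← Set.ncard_coe_finset]
  congr 1
  ext t
  simp

theorem ncard_touchedTriangles_zero (h : IsNearBase μ α) :
    (touchedTriangles (zeroSets (lineForms μ α)) 0).ncard = 17 := by
  rw [ncard_touchedTriangles h.isSimple h.lineForms_crossings, h.faceTriples_eq,
    ← card_isFaceTriple_zero, ← Set.ncard_coe_finset]
  have : {t ∈ {t : Fin 19 × Fin 19 × Fin 19 | isFaceTriple t = true} |
      0 = t.1 ∨ 0 = t.2.1 ∨ 0 = t.2.2} = Prod.mk 0 ''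
      (Finset.univ.filter fun p : Fin 19 × Fin 19 => isFaceTriple (0, p) = true : Set _) := by
    ext ⟨i, j, k⟩
    simp only [Set.mem_ofPred_eq, Finset.coe_filter, Finset.mem_univ, true_and, Set.mem_image,
      Prod.mk.injEq]
    constructor
    · rintro ⟨hf, h0⟩
      have hf' := hf
      simp only [isFaceTriple, Bool.and_eq_true, decide_eq_true_eq] at hf'
      -- In an increasing triple the least index `0` can only come first.
      have hi : 0 = i := by
        obtain ⟨h1, h2, -⟩ := hf'
        rcases h0 with h0 | h0 | h0 <;> omega
      subst hi
      exact ⟨(j, k), hf, rfl, rfl⟩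
    · rintro ⟨p, hp, rfl, rfl⟩
      exact ⟨hp, Or.inl rfl⟩
  rw [this, (Prod.mk_right_injective (0 : Fin 19)).injOn.ncard_image]

theorem realizesOMatrix (h : IsNearBase μ α) :
    RealizesOMatrix (zeroSets (lineForms μ α)) baseOMatrix := by
  have hs19 : ∀ i : Fin 19, μ i ≠ μ 19 := fun i =>
    h.slope_ne (val_lt_twenty i) (by norm_num) (by have := i.isLt; omega)
  have hsw := sweepCheck_eq_true
  simp only [sweepCheck, List.all_eq_true, List.mem_finRange, true_implies, Bool.or_eq_true,
    Bool.and_eq_true, beq_iff_eq, Bool.not_eq_true', decide_eq_false_iff_not] at hsw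
  have hoc := orderCheck_eq_true
  simp only [orderCheck, List.all_eq_true, List.mem_finRange, true_implies, Bool.or_eq_true,
    Bool.and_eq_true, bne_iff_ne, Bool.not_eq_true', decide_eq_false_iff_not] at hoc
  -- The normal `(μ 19, -1)` points downwards, so a crossing is still to be swept exactly when it
  -- lies below line `19`.
  refine ⟨h.isSimple, μ 19, -1, fun i t => ?_, ⟨μ 19 * α 19, fun i j hij p hi hj => ?_,
    fun i j hij p q hi hp hj hq => ?_⟩, fun i => ⟨fun k => (hoc i k).1, fun k l hkl => ?_,
    fun k l hkl p q hp hpk hq hql => ?_⟩⟩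
  · have hne := sub_ne_zero.2 (hs19 i).symm
    refine ⟨((t - μ i * α i) / (μ 19 - μ i), μ i * ((t - μ i * α i) / (μ 19 - μ i) - α i)),
      ⟨?_, ?_⟩, ?_⟩
    · simp [zeroSets, lineForms]
    · field_simp
      ring
    · rintro ⟨x, y⟩ ⟨h1, h2⟩
      simp only [zeroSets, lineForms, lineForm_apply, Set.mem_ofPred_eq] at h1 h2
      have hx : x = (t - μ i * α i) / (μ 19 - μ i) := by
        rw [eq_div_iff hne]; linarith
      rw [← hx]
      refine Prod.ext rfl ?_
      simp only
      linarith
  · obtain rfl := h.eq_crossings hij hi hj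
    have := h.isAbove_spec (l := 19) (by norm_num) (val_lt_twenty i) (val_lt_twenty j)
      (Fin.val_ne_of_ne hij) (by have := i.isLt; omega) (by have := j.isLt; omega)
    rw [((hsw i j).resolve_left hij).1] at this
    simp only [Bool.false_eq_true, if_false, lineForm_apply] at this
    simp only [crossings]
    linarith
  · have hp19 : lineForm (μ 19) (α 19) p = 0 := by rw [lineForm_apply]; linarith
    have hpc := eq_crossing (hs19 i) hi hp19
    have hab := h.isAbove_spec (val_lt_twenty j) (val_lt_twenty i) (j := 19) (by norm_num)
      (by have := i.isLt; omega) (Fin.val_ne_of_ne hij.ne) (by have := j.isLt; omega)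
    rw [← hpc] at hab
    have hsl := h.slope_lt (i := 19) (by norm_num) (val_lt_twenty j) (by have := j.isLt; omega)
    rw [((hsw i j).resolve_left hij.ne).2.resolve_left (not_not.2 hij)] at hab
    simp only [zeroSets, lineForms, lineForm_apply, Set.mem_ofPred_eq] at hj hab
    -- On the sweep line, the form of line `j` at `p` is `(μ 19 - μ j) * (p.1 - q.1)`, so its sign
    -- orders the abscissas.
    have hlt : p.1 < q.1 := by
      split_ifs at hab hsl <;> nlinarith
    have hdiff : μ 19 * (q.2 - p.2) = μ 19 ^ 2 * (q.1 - p.1) := by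
      rw [show q.2 - p.2 = μ 19 * (q.1 - p.1) by linarith]; ring
    have := mul_nonneg (sq_nonneg (μ 19)) (sub_nonneg.2 hlt.le)
    linarith
  · by_contra hne
    rcases lt_or_gt_of_ne hne with hlt | hlt
    · exact (((hoc i l).2 k).resolve_left (not_not.2 hlt)).1 hkl
    · exact (((hoc i k).2 l).resolve_left (not_not.2 hlt)).1 hkl.symm
  · obtain ⟨hne, hx⟩ := ((hoc i l).2 k).resolve_left (not_not.2 hkl)
    have hik := Fin.val_ne_of_ne (hoc i k).1.symm
    have hil := Fin.val_ne_of_ne (hoc i l).1.symm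
    have hab := h.isAbove_spec (val_lt_twenty (baseOMatrix i l)) (val_lt_twenty i)
      (val_lt_twenty (baseOMatrix i k)) hik hil (Fin.val_ne_of_ne hne)
    have hpc := h.eq_crossings (hoc i k).1.symm hp hpk
    rw [crossings] at hpc
    rw [← hpc] at hab
    have hs1 := h.slope_lt (val_lt_twenty i) (j := 19) (by norm_num) (by have := i.isLt; omega)
    have hs2 := h.slope_lt (val_lt_twenty i) (val_lt_twenty (baseOMatrix i l)) hil
    simp only [zeroSets, lineForms, lineForm_apply, Set.mem_ofPred_eq] at hp hq hql hab
    generalize baseOMatrix i l = j at *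
    generalize isAbove j i (baseOMatrix i k) = b1 at *
    generalize slopeLt i 19 = b2 at *
    generalize slopeLt i j = b3 at *
    have hpy : p.2 = μ i * (p.1 - α i) := by linarith
    have hqy : q.2 = μ i * (q.1 - α i) := by linarith
    -- On line `i` the sweep time changes by `(μ 19 - μ i)` times the change of abscissa. The
    -- exclusive or in `orderCheck` is the product of the three signs that determine this.
    have hgoal : 0 < (μ 19 - μ i) * (q.1 - p.1) := by
      have hform : p.2 - μ j * (p.1 - α j) = (μ i - μ j) * (p.1 - q.1) := by linarith
      rw [hform] at hab
      cases b1 <;> cases b2 <;> cases b3 <;> simp at hx hab hs1 hs2 <;> nlinarith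
    rw [hpy, hqy]
    linarith

end IsNearBase

/-! ### The base configuration -/

/-- The slopes of `Y₀`, of the lines `Lᵢ`, and of the sweep line. -/
noncomputable def extendedSlope (m : Fin 18 → ℝ) : ℕ → ℝ
  | 0 => 0
  -- The slope `1 / 10` lies between that of `Y₀` and the least positive slope, that of `L₁₈`, so
  -- far out the sweep line meets `Y₀` first and `L₁₈` last. The intercept `-10 ^ 6` puts it above
  -- all crossings.
  | i + 1 => if h : i < 18 then m ⟨i, h⟩ else 1 / 10

/-- The intercepts of `Y₀`, of the lines `Lᵢ`, and of the sweep line. -/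
noncomputable def extendedIntercept (a : Fin 18 → ℝ) : ℕ → ℝ
  | 0 => 0
  | i + 1 => if h : i < 18 then a ⟨i, h⟩ else -10 ^ 6

theorem normalizedFamily_eq_zeroSets (m a : Fin 18 → ℝ) :
    normalizedFamily m a = zeroSets (lineForms (extendedSlope m) (extendedIntercept a)) := by
  funext i
  refine Fin.cases ?_ (fun i => ?_) i
  · ext p
    simp [normalizedFamily, zeroSets, lineForms, extendedSlope]
  · ext p
    simp [normalizedFamily, zeroSets, lineForms, extendedSlope, extendedIntercept, sub_eq_zero]

theorem isNearBase_extended {ε : ℝ} (hε : ε ∈ Set.Ioo (0 : ℝ) (10 ^ (-4 : ℤ))) {m : Fin 18 → ℝ}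
    (hm : ∀ i, m i ∈ Set.Icc (slopeCenter i - 10 ^ (-4 : ℤ)) (slopeCenter i + 10 ^ (-4 : ℤ))) :
    IsNearBase (extendedSlope m) (extendedIntercept (intercept ε)) := by
  have hpow : (10 : ℝ) ^ (-4 : ℤ) = 1 / 10000 := by norm_num
  rw [hpow] at hε hm
  obtain ⟨hε0, hε1⟩ := hε
  refine ⟨fun i hi => ?_, fun i hi => ?_, rfl, ?_⟩
  · rcases i with _ | i
    · simp [extendedSlope, slopeInterval, InInterval]
    rcases (by omega : i < 18 ∨ i = 18) with h | rfl
    · have := hm ⟨i, h⟩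
      simp only [extendedSlope, h, dif_pos]
      generalize m ⟨i, h⟩ = x at *
      obtain ⟨h1, h2⟩ := this
      interval_cases i <;> simp [slopeCenter, slopeInterval, InInterval] at h1 h2 ⊢ <;>
        constructor <;> linarith
    · simp [extendedSlope, slopeInterval, InInterval]
      norm_num
  · rcases i with _ | i
    · simp [extendedIntercept, interceptInterval, InInterval]
    rcases (by omega : i < 18 ∨ i = 18) with h | rfl
    · have t1 := tan_pi_div_eighteen_bounds
      have t2 := tan_two_pi_div_eighteen_bounds
      have t3 := tan_three_pi_div_eighteen_bounds
      have t4 := tan_four_pi_div_eighteen_bounds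
      have t5 := tan_five_pi_div_eighteen_bounds
      have t6 := tan_six_pi_div_eighteen_bounds
      have t7 := tan_seven_pi_div_eighteen_bounds
      have t8 := tan_eight_pi_div_eighteen_bounds
      simp only [Set.mem_Icc] at t1 t2 t3 t4 t5 t6 t7 t8
      simp only [extendedIntercept, h, dif_pos, intercept]
      generalize Real.tan (1 * Real.pi / 18) = x1 at *
      generalize Real.tan (2 * Real.pi / 18) = x2 at *
      generalize Real.tan (3 * Real.pi / 18) = x3 at *
      generalize Real.tan (4 * Real.pi / 18) = x4 at *
      generalize Real.tan (5 * Real.pi / 18) = x5 at *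
      generalize Real.tan (6 * Real.pi / 18) = x6 at *
      generalize Real.tan (7 * Real.pi / 18) = x7 at *
      generalize Real.tan (8 * Real.pi / 18) = x8 at *
      interval_cases i <;> simp [interceptInterval, InInterval] <;> constructor <;> linarith
    · simp [extendedIntercept, interceptInterval, InInterval]
      norm_num
  · simp [extendedIntercept, intercept]
    linarith

theorem mem_tanNodes_eighteen {x : ℝ} :
    x ∈ tanNodes 18 ↔ ∃ k : ℕ, 1 ≤ k ∧ k ≤ 8 ∧
      (x = Real.tan (k * Real.pi / 18) ∨ x = -Real.tan (k * Real.pi / 18)) := by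
  simp [tanNodes]

theorem image_intercept (ε : ℝ) : intercept ε '' {i | i ≠ 7 ∧ i ≠ 14} = tanNodes 18 := by
  ext x
  rw [mem_tanNodes_eighteen]
  constructor
  · rintro ⟨i, ⟨h7, h14⟩, rfl⟩
    fin_cases i
    · exact ⟨8, by norm_num, by norm_num, by simp [intercept]⟩
    · exact ⟨4, by norm_num, by norm_num, by simp [intercept]⟩
    · exact ⟨6, by norm_num, by norm_num, by simp [intercept]⟩
    · exact ⟨7, by norm_num, by norm_num, by simp [intercept]⟩
    · exact ⟨1, by norm_num, by norm_num, by simp [intercept]⟩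
    · exact ⟨5, by norm_num, by norm_num, by simp [intercept]⟩
    · exact ⟨5, by norm_num, by norm_num, by simp [intercept]⟩
    · exact absurd rfl h7
    · exact ⟨2, by norm_num, by norm_num, by simp [intercept]⟩
    · exact ⟨3, by norm_num, by norm_num, by simp [intercept]⟩
    · exact ⟨7, by norm_num, by norm_num, by simp [intercept]⟩
    · exact ⟨3, by norm_num, by norm_num, by simp [intercept]⟩
    · exact ⟨2, by norm_num, by norm_num, by simp [intercept]⟩
    · exact ⟨4, by norm_num, by norm_num, by simp [intercept]⟩
    · exact absurd rfl h14
    · exact ⟨6, by norm_num, by norm_num, by simp [intercept]⟩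
    · exact ⟨1, by norm_num, by norm_num, by simp [intercept]⟩
    · exact ⟨8, by norm_num, by norm_num, by simp [intercept]⟩
  · rintro ⟨k, hk1, hk8, rfl | rfl⟩
    · interval_cases k
      · exact ⟨4, by decide, by simp [intercept]⟩
      · exact ⟨12, by decide, by simp [intercept]⟩
      · exact ⟨9, by decide, by simp [intercept]⟩
      · exact ⟨13, by decide, by simp [intercept]⟩
      · exact ⟨5, by decide, by simp [intercept]⟩
      · exact ⟨15, by decide, by simp [intercept]⟩
      · exact ⟨3, by decide, by simp [intercept]⟩
      · exact ⟨17, by decide, by simp [intercept]⟩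
    · interval_cases k
      · exact ⟨16, by decide, by simp [intercept]⟩
      · exact ⟨8, by decide, by simp [intercept]⟩
      · exact ⟨11, by decide, by simp [intercept]⟩
      · exact ⟨1, by decide, by simp [intercept]⟩
      · exact ⟨6, by decide, by simp [intercept]⟩
      · exact ⟨2, by decide, by simp [intercept]⟩
      · exact ⟨10, by decide, by simp [intercept]⟩
      · exact ⟨0, by decide, by simp [intercept]⟩

theorem range_intercept (ε : ℝ) : Set.range (intercept ε) = tanNodes 18 ∪ {-ε, ε} := by
  have : (Set.univ : Set (Fin 18)) = {i | i ≠ 7 ∧ i ≠ 14} ∪ {7, 14} := by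
    ext i; simp; tauto
  rw [← Set.image_univ, this, Set.image_union, image_intercept, Set.image_pair]
  simp [intercept]

end LineArrangement

theorem theorem4p1 (ε : ℝ) (hε : ε ∈ Set.Ioo (0 : ℝ) (10 ^ (-4 : ℤ)))
    (m : Fin 18 → ℝ)
    (hm : ∀ i, m i ∈ Set.Icc (slopeCenter i - 10 ^ (-4 : ℤ)) (slopeCenter i + 10 ^ (-4 : ℤ))) :
    IsSimple (normalizedFamily m (intercept ε)) ∧
    normalizedFamily m (intercept ε) 0 = {p : ℝ × ℝ | p.2 = 0} ∧
    (∀ i : Fin 18, normalizedFamily m (intercept ε) i.succ =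
      {p : ℝ × ℝ | p.2 = m i * (p.1 - intercept ε i)}) ∧
    Set.range (intercept ε) = tanNodes 18 ∪ {-ε, ε} ∧
    ε < 1 / 36 ∧
    RealizesOMatrix (normalizedFamily m (intercept ε)) baseOMatrix ∧
    (touchedTriangles (normalizedFamily m (intercept ε)) 0).ncard = 17 ∧
    (boundedTriangles (normalizedFamily m (intercept ε))).ncard = 107 ∧
    BBLIterationHypotheses m (intercept ε) 7 14 := by
  have h := isNearBase_extended hε hm
  have hf := normalizedFamily_eq_zeroSets m (intercept ε)
  obtain ⟨hε0, hε1⟩ := hε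
  have hε2 : ε < 1 / 10000 := by norm_num at hε1 ⊢; exact hε1
  have h7 : intercept ε 7 = -ε := by simp [intercept]
  have h14 : intercept ε 14 = ε := by simp [intercept]
  have hs : IsSimple (normalizedFamily m (intercept ε)) := by rw [hf]; exact h.isSimple
  have ht : (touchedTriangles (normalizedFamily m (intercept ε)) 0).ncard = 17 := by
    rw [hf]; exact h.ncard_touchedTriangles_zero
  refine ⟨hs, rfl, fun i => rfl, range_intercept ε, by linarith,
    by rw [hf]; exact h.realizesOMatrix, ht, by rw [hf]; exact h.ncard_boundedTriangles, ?_⟩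
  -- The special lines `L₈` and `L₁₅` have the zero-based positions `7` and `14`.
  refine ⟨by norm_num, by decide, by decide, hs, image_intercept ε, ?_, ?_, ht, ?_⟩
  · rw [h7]; constructor <;> norm_num <;> linarith
  · rw [h14]; constructor <;> norm_num <;> linarith
  · rw [h7, h14, abs_neg, abs_of_pos hε0]; constructor <;> norm_num <;> linarith
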